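/- Let $\mathcal{W}$ be the category of compactly generated weakly Hausdorff spaces and continuous maps, where a space $X$ is compactly generated if it carries the finest topology for which all continuous maps $K\to X$ from compact Hausdorff spaces $K$ remain continuous, and weakly Hausdorff if each such map has closed image. For $X,Y\in\mathcal{W}$ let $[X,Y]\in\mathcal{W}$ be the set of continuous maps $X\to Y$ equipped with the $\mathbf{k}$-ification of the compact-open topology (that is, with the finest topology for which all maps from compact Hausdorff spaces that are continuous for the compact-open topology remain continuous). Let $C\in\mathcal{W}$, viewed as a comonoid via its diagonal $C\to C\times C$ and the map $C\to\mathrm{pt}$. This comonoid makes $F\colon \mathcal{W}\to\mathcal{W}$, $FX=[C,X]$, a monad, with unit $X\to[C,X]$ sending a point to the corresponding constant map and multiplication $[C,[C,X]]\cong[C\times C,X]\to[C,X]$ sending $f$ to $c\mapsto f(c)(c)$. Let $\mathcal{W}^F$ be the category of algebras over this monad (contraspaces over $C$): its objects are the spaces $X\in\mathcal{W}$ with a continuous map $\theta_X\colon[C,X]\to X$ satisfying the unit and associativity axioms, and its morphisms are the continuous maps commuting with the structure maps. Then the category $\mathcal{W}^F$ is cocomplete, i.e. it has all small colimits. -/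

import Mathlib

open CategoryTheory Limits Topology

universe u

/-- A space `X` is weakly Hausdorff if every continuous map from a compact Hausdorff space to `X`
has closed image. -/
class WeaklyHausdorffSpace (X : Type u) [TopologicalSpace X] : Prop where
  isClosed_range : ∀ (K : Type u) [TopologicalSpace K] [CompactSpace K] [T2Space K] (f : C(K, X)),
    IsClosed (Set.range f)

/-- The `k`-ification of a space `Y`: the same underlying set, equipped with the finest topology
for which all continuous maps from compact Hausdorff spaces to `Y` remain continuous. -/
def Kification (Y : Type u) [TopologicalSpace Y] : Type u := Y

instance Kification.instTopologicalSpace (Y : Type u) [TopologicalSpace Y] :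
    TopologicalSpace (Kification Y) :=
  TopologicalSpace.compactlyGenerated.{u} Y

namespace Kification

variable {Y : Type u} [TopologicalSpace Y]

/-- The identity bijection from a space to its `k`-ification. -/
def mk : Y ≃ Kification Y := Equiv.refl Y

theorem continuous_of_comp {Z : Type u} [TopologicalSpace Z] {g : Kification Y → Z}
    (h : ∀ (S : Type u) [TopologicalSpace S] [CompactSpace S] [T2Space S] (f : C(S, Y)),
      Continuous fun s ↦ g (mk (f s))) : Continuous g :=
  continuous_from_compactlyGenerated (X := Y) g fun S f ↦ h S f

theorem continuous_mk_symm : Continuous (mk.symm : Kification Y → Y) :=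
  continuous_of_comp fun _ _ _ _ f ↦ f.continuous

theorem continuous_mk_comp {Z : Type u} [TopologicalSpace Z] [CompactlyGeneratedSpace Z]
    {g : Z → Y} (hg : Continuous g) : Continuous fun z ↦ (mk (g z) : Kification Y) := by
  refine continuous_from_uCompactlyGeneratedSpace.{u} _ fun S p ↦ ?_
  have h : Continuous (fun x : (Σ i : (S : CompHaus.{u}) × C(S, Y), i.fst) ↦
      (mk (x.1.2 x.2) : Kification Y)) := continuous_coinduced_rng
  exact h.comp (continuous_sigmaMk (σ := fun i : (S : CompHaus.{u}) × C(S, Y) ↦ i.fst)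
    (i := ⟨S, ⟨fun s ↦ g (p s), hg.comp p.continuous⟩⟩))

instance : CompactlyGeneratedSpace (Kification Y) :=
  compactlyGeneratedSpace_of_continuous_maps fun _ hg ↦ continuous_of_comp fun S _ _ _ f ↦
    hg S _ (continuous_mk_comp f.continuous)

end Kification

/-- In a weakly Hausdorff space, the coincidence set of two continuous maps from
compact Hausdorff spaces is closed. -/
theorem WeaklyHausdorffSpace.isClosed_coincidence {X : Type u} [TopologicalSpace X]
    [WeaklyHausdorffSpace X] {K L : Type u} [TopologicalSpace K] [CompactSpace K] [T2Space K]
    [TopologicalSpace L] [CompactSpace L] [T2Space L] (a : C(K, X)) (b : C(L, X)) :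
    IsClosed {p : K × L | a p.1 = b p.2} := by
  have key : ∀ (P : Type u) [TopologicalSpace P] [CompactSpace P] [T2Space P] (f : C(P, X)),
      IsClosed {p : P × P | f p.1 = f p.2} := by
    intro P _ _ _ f
    have hf : IsClosedMap f := by
      intro A hA
      have : CompactSpace A := isCompact_iff_compactSpace.1 hA.isCompact
      have h := WeaklyHausdorffSpace.isClosed_range A
        (f.comp ⟨(Subtype.val : A → P), continuous_subtype_val⟩)
      convert h using 1
      ext x
      constructor
      · rintro ⟨y, hy, rfl⟩
        exact ⟨⟨y, hy⟩, rfl⟩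
      · rintro ⟨y, rfl⟩
        exact ⟨y.1, y.2, rfl⟩
    have hpt : ∀ x, IsClosed (f ⁻¹' {f x}) := fun x ↦ by
      have h := hf {x} isClosed_singleton
      rw [Set.image_singleton] at h
      exact h.preimage f.continuous
    rw [← isOpen_compl_iff, isOpen_iff_mem_nhds]
    rintro ⟨x, y⟩ hxy
    have hne : f x ≠ f y := hxy
    have hd : Disjoint (f ⁻¹' {f x}) (f ⁻¹' {f y}) := by
      rw [Set.disjoint_left]
      intro z hz hz'
      exact hne ((show f z = f x from hz).symm.trans hz')
    obtain ⟨U, V, hU, hV, hxU, hyV, hUV⟩ := normal_separation (hpt x) (hpt y) hd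
    have hop : ∀ U : Set P, IsOpen U → IsOpen (f ⁻¹' (f '' Uᶜ))ᶜ := fun U hU ↦
      ((hf _ hU.isClosed_compl).preimage f.continuous).isOpen_compl
    have hmem : ∀ (U : Set P) (z : P), f ⁻¹' {f z} ⊆ U → z ∈ (f ⁻¹' (f '' Uᶜ))ᶜ := by
      rintro U z hz ⟨w, hw, hwz⟩
      exact hw (hz hwz)
    filter_upwards [((hop U hU).prod (hop V hV)).mem_nhds ⟨hmem U x hxU, hmem V y hyV⟩]
    rintro ⟨z, w⟩ ⟨hz, hw⟩ hzw
    have hzw' : f z = f w := hzw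
    have hzU : z ∈ U := by
      by_contra h
      exact hz ⟨z, h, rfl⟩
    have hzV : z ∈ V := by
      by_contra h
      exact hw ⟨z, h, hzw'⟩
    exact Set.disjoint_left.1 hUV hzU hzV
  have hs := key (K ⊕ L) ⟨Sum.elim a b, a.continuous.sumElim b.continuous⟩
  have hc : Continuous fun p : K × L ↦ ((Sum.inl p.1, Sum.inr p.2) : (K ⊕ L) × (K ⊕ L)) := by
    fun_prop
  exact hs.preimage hc

/-- The internal hom `[X, Y]`: the set of continuous maps `X → Y` with the `k`-ification of the
compact-open topology. -/
abbrev MappingSpace (X Y : Type u) [TopologicalSpace X] [TopologicalSpace Y] : Type u :=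
  Kification C(X, Y)

namespace MappingSpace

variable {X Y Z : Type u} [TopologicalSpace X] [TopologicalSpace Y] [TopologicalSpace Z]

instance : FunLike (MappingSpace X Y) X Y where
  coe f := (Kification.mk.symm f : C(X, Y))
  coe_injective f g h := by
    exact Kification.mk.symm.injective (DFunLike.coe_injective h)

@[ext]
theorem ext {f g : MappingSpace X Y} (h : ∀ x, f x = g x) : f = g := DFunLike.ext _ _ h

/-- A continuous map, as a point of the mapping space. -/
def of (f : C(X, Y)) : MappingSpace X Y := Kification.mk f

@[simp] theorem of_apply (f : C(X, Y)) (x : X) : of f x = f x := rfl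

theorem continuous_coe (f : MappingSpace X Y) : Continuous f :=
  (Kification.mk.symm f : C(X, Y)).continuous

instance [WeaklyHausdorffSpace Y] : WeaklyHausdorffSpace (MappingSpace X Y) where
  isClosed_range K _ _ _ h := by
    refine CompactlyGeneratedSpace.isClosed' fun L _ _ _ g hg ↦ ?_
    have hev : ∀ x : X, Continuous fun f : MappingSpace X Y ↦ f x := fun x ↦
      (ContinuousEvalConst.continuous_eval_const (F := C(X, Y)) x).comp Kification.continuous_mk_symm
    have hcl : IsClosed {p : K × L | h p.1 = g p.2} := by
      have : {p : K × L | h p.1 = g p.2} = ⋂ x : X, {p : K × L | h p.1 x = g p.2 x} := by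
        ext p
        simp only [Set.mem_ofPred_eq, Set.mem_iInter]
        exact ⟨fun e x ↦ by rw [e], fun e ↦ ext e⟩
      rw [this]
      exact isClosed_iInter fun x ↦ WeaklyHausdorffSpace.isClosed_coincidence
        ⟨fun k ↦ h k x, (hev x).comp h.continuous⟩ ⟨fun l ↦ g l x, (hev x).comp hg⟩
    have him := isClosedMap_snd_of_compactSpace _ hcl
    convert him using 1
    ext l
    constructor
    · rintro ⟨k, hk⟩
      exact ⟨(k, l), hk, rfl⟩
    · rintro ⟨⟨k, l'⟩, hk, rfl⟩
      exact ⟨k, hk⟩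

/-- Postcomposition with a continuous map. -/
def postcomp (g : C(Y, Z)) : C(MappingSpace X Y, MappingSpace X Z) where
  toFun f := of (g.comp ⟨f, f.continuous_coe⟩)
  continuous_toFun := Kification.continuous_mk_comp
    ((ContinuousMap.continuous_postcomp g).comp Kification.continuous_mk_symm)

@[simp] theorem postcomp_apply (g : C(Y, Z)) (f : MappingSpace X Y) (x : X) :
    postcomp g f x = g (f x) := rfl

/-- The map `Y → [X, Y]` sending a point to the corresponding constant map. -/
def const (X Y : Type u) [TopologicalSpace X] [TopologicalSpace Y] [CompactlyGeneratedSpace Y] :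
    C(Y, MappingSpace X Y) where
  toFun y := of (ContinuousMap.const X y)
  continuous_toFun := Kification.continuous_mk_comp ContinuousMap.continuous_const'

@[simp] theorem const_apply [CompactlyGeneratedSpace Y] (y : Y) (x : X) :
    const X Y y x = y := rfl

/-- If `S` and `T` are compact Hausdorff, a continuous map `S → C(X, [X, Y])` and a continuous map
`T → X` induce a continuous map on `T × S` by evaluating twice. -/
theorem continuous_eval_eval {S T : Type u} [TopologicalSpace S] [CompactSpace S] [T2Space S]
    [TopologicalSpace T] [CompactSpace T] [T2Space T] (p : C(S, C(X, MappingSpace X Y)))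
    (g : C(T, X)) : Continuous fun q : T × S ↦ p q.2 (g q.1) (g q.1) := by
  have h1 : Continuous fun s : S ↦ (p s).comp g :=
    (ContinuousMap.continuous_precomp g).comp p.continuous
  have h2 : Continuous fun q : T × S ↦ p q.2 (g q.1) :=
    (ContinuousMap.continuous_uncurry_of_continuous ⟨_, h1⟩).comp continuous_swap
  have h3 : Continuous fun q : T × S ↦
      ((Kification.mk.symm (p q.2 (g q.1)) : C(X, Y)).comp g : C(T, Y)) :=
    (ContinuousMap.continuous_precomp g).comp (Kification.continuous_mk_symm.comp h2)
  exact (ContinuousMap.continuous_uncurry_of_continuous ⟨_, h3⟩).comp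
    (continuous_id.prodMk continuous_fst)

theorem continuous_diag_uncurry [CompactlyGeneratedSpace X] {S : Type u} [TopologicalSpace S]
    [CompactSpace S] [T2Space S] (p : C(S, C(X, MappingSpace X Y))) : Continuous fun q : X × S ↦ p q.2 q.1 q.1 := by
  have hx : ∀ x : X, Continuous fun s : S ↦ p s x x := fun x ↦
    (continuous_eval_eval p (ContinuousMap.const S x)).comp (continuous_id.prodMk continuous_id)
  have h : Continuous fun x : X ↦ (⟨fun s ↦ p s x x, hx x⟩ : C(S, Y)) := by
    refine continuous_from_compactlyGeneratedSpace _ fun T _ _ _ g hg ↦ ?_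
    exact ContinuousMap.continuous_of_continuous_uncurry _ (continuous_eval_eval p ⟨g, hg⟩)
  exact ContinuousMap.continuous_uncurry_of_continuous ⟨_, h⟩

theorem continuous_diag [CompactlyGeneratedSpace X] (f : MappingSpace X (MappingSpace X Y)) :
    Continuous fun x ↦ f x x :=
  (continuous_diag_uncurry (S := PUnit.{u + 1})
    (ContinuousMap.const _ (Kification.mk.symm f : C(X, MappingSpace X Y)))).comp
    (continuous_id.prodMk (continuous_const (y := PUnit.unit)))

/-- The composite `[X, [X, Y]] ≅ [X × X, Y] → [X, Y]`, where the second map is precomposition with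
the diagonal of `X`; it sends `f` to the map `x ↦ f x x`. -/
def diag (X Y : Type u) [TopologicalSpace X] [TopologicalSpace Y] [CompactlyGeneratedSpace X] :
    C(MappingSpace X (MappingSpace X Y), MappingSpace X Y) where
  toFun f := of ⟨fun x ↦ f x x, continuous_diag f⟩
  continuous_toFun := by
    refine Kification.continuous_of_comp fun S _ _ _ p ↦ ?_
    refine Kification.continuous_mk_comp ?_
    exact ContinuousMap.continuous_of_continuous_uncurry _
      ((continuous_diag_uncurry p).comp continuous_swap)

@[simp] theorem diag_apply [CompactlyGeneratedSpace X] (f : MappingSpace X (MappingSpace X Y))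
    (x : X) : diag X Y f x = f x x := rfl

end MappingSpace

/-- The property of being compactly generated and weakly Hausdorff. -/
def TopCat.isCGWH : ObjectProperty TopCat.{u} :=
  fun X ↦ CompactlyGeneratedSpace X ∧ WeaklyHausdorffSpace X

/-- The category of compactly generated weakly Hausdorff spaces and continuous maps. -/
abbrev CGWH : Type (u + 1) := TopCat.isCGWH.{u}.FullSubcategory

namespace CGWH

instance (X : CGWH.{u}) : CompactlyGeneratedSpace X.obj := X.property.1

instance (X : CGWH.{u}) : WeaklyHausdorffSpace X.obj := X.property.2

/-- A compactly generated weakly Hausdorff space, as an object of the category. -/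
abbrev of (X : Type u) [TopologicalSpace X] [CompactlyGeneratedSpace X] [WeaklyHausdorffSpace X] :
    CGWH.{u} :=
  ⟨TopCat.of X, ‹_›, ‹_›⟩

/-- A continuous map, as a morphism of the category. -/
abbrev ofHom {X Y : CGWH.{u}} (f : C(X.obj, Y.obj)) : X ⟶ Y :=
  TopCat.isCGWH.homMk (TopCat.ofHom f)

/-- The functor `X ↦ [C, X]`. -/
def homFunctor (C : CGWH.{u}) : CGWH.{u} ⥤ CGWH.{u} where
  obj X := of (MappingSpace C.obj X.obj)
  map f := ofHom (MappingSpace.postcomp f.hom.hom)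

/-- The monad `X ↦ [C, X]` given by the diagonal comonoid structure on `C`: the unit `X ⟶ [C, X]`
is induced by the counit `C → pt` (it sends a point to a constant map), and the multiplication
`[C, [C, X]] ⟶ [C, X]` is induced by the diagonal `C → C × C` (it sends `f` to `c ↦ f c c`). -/
def contraMonad (C : CGWH.{u}) : Monad CGWH.{u} where
  toFunctor := homFunctor C
  η := { app X := ofHom (MappingSpace.const C.obj X.obj) }
  μ := { app X := ofHom (MappingSpace.diag C.obj X.obj) }

/-- The category of contraspaces over `C`: the category of algebras for the monad `X ↦ [C, X]`,
that is, of spaces `X` with a continuous map `θ : [C, X] → X` satisfying the unit and associativity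
axioms, and continuous maps commuting with the structure maps. -/
abbrev Contraspace (C : CGWH.{u}) : Type (u + 1) := (contraMonad C).Algebra

end CGWH

/-! A category has colimits of shape `J` when the diagonal functor to `J`-diagrams has a left
adjoint, and the general adjoint functor theorem supplies one. Two inputs are needed. Completeness:
limits of CGWH spaces are `k`-ified topological limits, and the forgetful functor from algebras
creates limits. Solution sets: a cocone from `D` to `Y` factors through any subset of `Y` that
contains the images and is closed under contraaction. Such a subset need not be closed in `Y`: its
`k`-ified subspace topology is weakly Hausdorff because it injects continuously into `Y`, and the
structure map restricts. The subset can be taken to consist of values of well-founded `C`-branching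
terms in the points of `D` (`exists_isClosedUnder`), so its size is bounded independently of `Y`. -/

/-- A compactly generated space with a jointly injective family of continuous maps to
weakly Hausdorff spaces is weakly Hausdorff. -/
theorem WeaklyHausdorffSpace.of_jointly_injective {Z : Type u} [TopologicalSpace Z]
    [CompactlyGeneratedSpace Z] {ι : Type*} {X : ι → Type u} [∀ i, TopologicalSpace (X i)]
    [∀ i, WeaklyHausdorffSpace (X i)] (f : ∀ i, Z → X i) (hf : ∀ i, Continuous (f i))
    (hinj : ∀ z w, (∀ i, f i z = f i w) → z = w) : WeaklyHausdorffSpace Z where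
  isClosed_range K _ _ _ h := by
    -- Closedness is tested on maps `g : L → Z`. The preimage of the range of `h` is the projection
    -- to `L` of a closed coincidence set in `K × L`, and this projection is closed since `K` is
    -- compact.
    refine CompactlyGeneratedSpace.isClosed' fun L _ _ _ g hg ↦ ?_
    have hcl : IsClosed {p : K × L | h p.1 = g p.2} := by
      have : {p : K × L | h p.1 = g p.2} = ⋂ i, {p : K × L | f i (h p.1) = f i (g p.2)} := by
        ext p
        simp only [Set.mem_ofPred_eq, Set.mem_iInter]
        exact ⟨fun e i ↦ by rw [e], hinj _ _⟩
      rw [this]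
      exact isClosed_iInter fun i ↦ WeaklyHausdorffSpace.isClosed_coincidence
        ⟨fun k ↦ f i (h k), (hf i).comp h.continuous⟩ ⟨fun l ↦ f i (g l), (hf i).comp hg⟩
    convert isClosedMap_snd_of_compactSpace _ hcl using 1
    ext l
    constructor
    · rintro ⟨k, hk⟩
      exact ⟨(k, l), hk, rfl⟩
    · rintro ⟨⟨k, l'⟩, hk, rfl⟩
      exact ⟨k, hk⟩

/-! ### Subalgebras over a monad -/

namespace CategoryTheory.Monad.Algebra

/-- A subobject of the carrier of an algebra to which the structure map restricts is an algebra. -/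
def ofMono {𝒞 : Type*} [Category 𝒞] {T : Monad 𝒞} (Y : T.Algebra) {Z : 𝒞} (i : Z ⟶ Y.A) [Mono i]
    (a : T.obj Z ⟶ Z) (h : a ≫ i = T.map i ≫ Y.a) : T.Algebra where
  A := Z
  a := a
  unit := by
    rw [← cancel_mono i, Category.assoc, h, ← T.η.naturality_assoc, Y.unit]
    exact (Category.comp_id i).trans (Category.id_comp i).symm
  assoc := by
    rw [← cancel_mono i, Category.assoc, Category.assoc, h, ← Functor.map_comp_assoc, h,
      Functor.map_comp_assoc, ← Y.assoc, ← T.μ.naturality_assoc]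
    rfl

variable {𝒞 : Type*} [Category 𝒞] {T : Monad 𝒞} (Y : T.Algebra) {Z : 𝒞} (i : Z ⟶ Y.A) [Mono i]
  (a : T.obj Z ⟶ Z) (h : a ≫ i = T.map i ≫ Y.a)

/-- The inclusion of a subalgebra. -/
def ofMonoHom : ofMono Y i a h ⟶ Y where
  f := i
  h := h.symm

instance : Mono (ofMonoHom Y i a h) :=
  T.forget.mono_of_mono_map (inferInstanceAs (Mono i))

variable {Y i}

/-- A morphism of algebras factors through a subalgebra if its underlying morphism does. -/
def ofMonoLift {W : T.Algebra} (φ : W ⟶ Y) (l : W.A ⟶ Z) (hl : l ≫ i = φ.f) :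
    W ⟶ ofMono Y i a h where
  f := l
  h := by
    change T.map l ≫ a = W.a ≫ l
    rw [← cancel_mono i, Category.assoc, Category.assoc, h, hl, ← φ.h, ← hl,
      Functor.map_comp_assoc]

end CategoryTheory.Monad.Algebra

namespace CGWH

theorem hom_ext {X Y : CGWH.{u}} {f g : X ⟶ Y} (h : ∀ x, f.hom.hom x = g.hom.hom x) : f = g :=
  ObjectProperty.hom_ext _ (TopCat.hom_ext (ContinuousMap.ext h))

/-! ### Limits of CGWH spaces -/

section Limits

variable {J : Type u} [Category.{u} J] (F : J ⥤ CGWH.{u})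

/-- The limit of a diagram of spaces, computed in all topological spaces. -/
noncomputable abbrev topLimit : TopCat.{u} := limit (F ⋙ TopCat.isCGWH.ι)

instance : WeaklyHausdorffSpace (Kification (topLimit F)) :=
  .of_jointly_injective (X := fun j ↦ (F.obj j).obj)
    (fun j z ↦ limit.π (F ⋙ TopCat.isCGWH.ι) j (Kification.mk.symm z))
    (fun j ↦ (limit.π (F ⋙ TopCat.isCGWH.ι) j).hom.continuous.comp Kification.continuous_mk_symm)
    fun _ _ h ↦ Kification.mk.symm.injective
      (Concrete.limit_ext (F ⋙ TopCat.isCGWH.ι) _ _ h)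

/-- The `k`-ification of the limit in topological spaces, as a cone. -/
noncomputable def limitCone : Cone F where
  pt := of (Kification (topLimit F))
  π :=
    { app j := ofHom (Y := F.obj j) ⟨fun z : Kification (topLimit F) ↦ limit.π (F ⋙ TopCat.isCGWH.ι) j (Kification.mk.symm z),
        (limit.π (F ⋙ TopCat.isCGWH.ι) j).hom.continuous.comp Kification.continuous_mk_symm⟩
      naturality _ _ f := hom_ext fun z : Kification (topLimit F) ↦
        (ConcreteCategory.congr_hom (limit.w (F ⋙ TopCat.isCGWH.ι) f)
          (Kification.mk.symm z)).symm }

/-- The `k`-ification of the limit in topological spaces is a limit. -/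
noncomputable def limitConeIsLimit : IsLimit (limitCone F) where
  lift s := ofHom ⟨fun x ↦ Kification.mk
      (limit.lift (F ⋙ TopCat.isCGWH.ι) (TopCat.isCGWH.ι.mapCone s) x),
    Kification.continuous_mk_comp (Z := s.pt.obj) (limit.lift (F ⋙ TopCat.isCGWH.ι) (TopCat.isCGWH.ι.mapCone s)).hom.continuous⟩
  fac s j := hom_ext fun x ↦
    ConcreteCategory.congr_hom (limit.lift_π (TopCat.isCGWH.ι.mapCone s) j) x
  uniq s _ hm := hom_ext fun x ↦ Kification.mk.symm.injective <|
    Concrete.limit_ext (F ⋙ TopCat.isCGWH.ι) _ _ fun j ↦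
      (ConcreteCategory.congr_hom (congrArg (·.hom) (hm j)) x).trans
        (ConcreteCategory.congr_hom (limit.lift_π (TopCat.isCGWH.ι.mapCone s) j) x).symm

end Limits

instance : HasLimitsOfSize.{u, u} CGWH.{u} where
  has_limits_of_shape _ _ := ⟨fun F ↦ ⟨⟨⟨limitCone F, limitConeIsLimit F⟩⟩⟩⟩

namespace Contraspace

variable {C : CGWH.{u}}

instance : HasLimitsOfSize.{u, u} (Contraspace C) where
  has_limits_of_shape _ _ := ⟨fun D ↦ Monad.hasLimit_of_comp_forget_hasLimit D⟩

/-- The structure map of a contraspace. -/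
def contraaction (Y : Contraspace C) : C(MappingSpace C.obj Y.A.obj, Y.A.obj) := Y.a.hom.hom

/-! ### Subspaces closed under contraaction -/

section Subspace

variable (Y : Contraspace C) {Z : Type u} [TopologicalSpace Z] {e : Z → Y.A.obj}

theorem weaklyHausdorffSpace_kification (he : IsEmbedding e) :
    WeaklyHausdorffSpace (Kification Z) :=
  .of_jointly_injective (ι := Unit) (fun _ z ↦ e (Kification.mk.symm z))
    (fun _ ↦ he.continuous.comp Kification.continuous_mk_symm)
    fun _ _ h ↦ Kification.mk.symm.injective (he.injective (h ()))

variable [WeaklyHausdorffSpace (Kification Z)]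

/-- The map to a space induced by an embedding, as a map on the `k`-ification. -/
def inclusion {Y : CGWH.{u}} {e : Z → Y.obj} (he : IsEmbedding e) : of (Kification Z) ⟶ Y :=
  ofHom ⟨fun z ↦ e (Kification.mk.symm z), he.continuous.comp Kification.continuous_mk_symm⟩

theorem inclusion_injective {Y : CGWH.{u}} {e : Z → Y.obj} (he : IsEmbedding e) :
    Function.Injective (inclusion he).hom.hom :=
  fun _ _ h ↦ (Kification.mk (Y := Z)).symm.injective (he.injective h)

instance {Y : CGWH.{u}} {e : Z → Y.obj} (he : IsEmbedding e) : Mono (inclusion he) where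
  right_cancellation _ _ h := hom_ext fun x ↦ inclusion_injective he <|
    ConcreteCategory.congr_hom (congrArg (·.hom) h) x

/-- A map to `Y` with image in the range of an embedding `e : Z → Y` factors through the
`k`-ification of `Z`. -/
noncomputable def inclusionLift {Y W : CGWH.{u}} {e : Z → Y.obj} (he : IsEmbedding e)
    (φ : W ⟶ Y) (hφ : ∀ w, φ.hom.hom w ∈ Set.range e) : W ⟶ of (Kification Z) :=
  ofHom ⟨fun w ↦ Kification.mk (hφ w).choose, Kification.continuous_mk_comp <|
    he.continuous_iff.2 <| by
      convert φ.hom.hom.continuous using 1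
      exact funext fun w ↦ (hφ w).choose_spec⟩

theorem inclusionLift_comp {Y W : CGWH.{u}} {e : Z → Y.obj} (he : IsEmbedding e)
    (φ : W ⟶ Y) (hφ : ∀ w, φ.hom.hom w ∈ Set.range e) :
    inclusionLift he φ hφ ≫ inclusion he = φ :=
  hom_ext fun w ↦ (hφ w).choose_spec

/-- A subset of a contraspace is closed under contraaction if the structure map sends maps
with values in the subset to points of the subset. -/
def IsClosedUnder (S : Set Y.A.obj) : Prop :=
  ∀ g : MappingSpace C.obj Y.A.obj, (∀ c, g c ∈ S) → Y.contraaction g ∈ S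

variable {Y}

/-- A subset closed under contraaction, with the `k`-ification of the subspace topology, as a
contraspace. -/
noncomputable def subspace (he : IsEmbedding e) (hS : Y.IsClosedUnder (Set.range e)) :
    Contraspace C :=
  Monad.Algebra.ofMono Y (inclusion he)
    (inclusionLift he ((contraMonad C).map (inclusion he) ≫ Y.a)
      fun g ↦ hS (MappingSpace.postcomp (inclusion he).hom.hom g) fun _ ↦ ⟨_, rfl⟩)
    (inclusionLift_comp he _ _)

/-- The inclusion of a subset closed under contraaction. -/
noncomputable def subspaceInclusion (he : IsEmbedding e) (hS : Y.IsClosedUnder (Set.range e)) :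
    subspace he hS ⟶ Y :=
  Monad.Algebra.ofMonoHom Y (inclusion he) _ (inclusionLift_comp he _ _)

/-- A morphism of contraspaces with image in a subset closed under contraaction factors through
that subset. -/
noncomputable def subspaceLift (he : IsEmbedding e) (hS : Y.IsClosedUnder (Set.range e))
    {W : Contraspace C} (φ : W ⟶ Y) (hφ : ∀ w, φ.f.hom.hom w ∈ Set.range e) :
    W ⟶ subspace he hS :=
  Monad.Algebra.ofMonoLift _ _ φ (inclusionLift he φ.f hφ) (inclusionLift_comp he _ _)

theorem subspaceLift_comp (he : IsEmbedding e) (hS : Y.IsClosedUnder (Set.range e))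
    {W : Contraspace C} (φ : W ⟶ Y) (hφ : ∀ w, φ.f.hom.hom w ∈ Set.range e) :
    subspaceLift he hS φ hφ ≫ subspaceInclusion he hS = φ :=
  Monad.Algebra.Hom.ext (inclusionLift_comp he φ.f hφ)

instance (he : IsEmbedding e) (hS : Y.IsClosedUnder (Set.range e)) :
    Mono (subspaceInclusion he hS) :=
  inferInstanceAs (Mono (Monad.Algebra.ofMonoHom Y (inclusion he) _ _))

end Subspace

/-! ### Generation by terms -/

section Generation

/-- Formal expressions in variables from `A` and an operation of arity `C`. -/
inductive Term (A C : Type u) : Type u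
  | var (a : A) : Term A C
  | op (f : C → Term A C) : Term A C

variable {A : Type u}

open Classical in
/-- The partial evaluation of formal expressions in a contraspace. -/
noncomputable def Term.eval (Y : Contraspace C) (v : A → Y.A.obj) :
    Term A C.obj → Option Y.A.obj
  | .var a => some (v a)
  | .op f =>
    -- The values of the subterms may be undefined or fail to vary continuously, whence partiality.
    -- They determine `g`, so the choice is harmless.
    if h : ∃ g : MappingSpace C.obj Y.A.obj, ∀ c, eval Y v (f c) = some (g c) then
      some (Y.contraaction h.choose)
    else none

theorem Term.eval_op (Y : Contraspace C) (v : A → Y.A.obj) (f : C.obj → Term A C.obj)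
    (g : MappingSpace C.obj Y.A.obj) (hg : ∀ c, (f c).eval Y v = some (g c)) :
    (Term.op f).eval Y v = some (Y.contraaction g) := by
  have h : ∃ g : MappingSpace C.obj Y.A.obj, ∀ c, (f c).eval Y v = some (g c) := ⟨g, hg⟩
  have hgg : h.choose = g :=
    MappingSpace.ext fun c ↦ Option.some_injective _ ((h.choose_spec c).symm.trans (hg c))
  rw [Term.eval, dif_pos h, hgg]

/-- A family of points of a contraspace is contained in a subset closed under contraaction that is
parametrized by a set of formal expressions. -/
theorem exists_isClosedUnder (Y : Contraspace C) (v : A → Y.A.obj) :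
    ∃ (s : Set (Term A C.obj)) (e : s → Y.A.obj), Function.Injective e ∧
      Y.IsClosedUnder (Set.range e) ∧ ∀ a, v a ∈ Set.range e := by
  let S : Set Y.A.obj := {y | ∃ t : Term A C.obj, t.eval Y v = some y}
  -- One term for each value: `S` is in bijection with a set of terms, a type that does not depend
  -- on `Y`.
  choose σ hσ using fun y : S ↦ y.2
  have hinj : Function.Injective σ := fun x y h ↦
    Subtype.ext (Option.some_injective _ ((hσ x).symm.trans ((congrArg _ h).trans (hσ y))))
  let E := Equiv.ofInjective σ hinj
  have hr : Set.range (fun t ↦ (E.symm t : Y.A.obj)) = S := by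
    rw [← Function.comp_def, Set.range_comp, E.symm.range_eq_univ, Set.image_univ,
      Subtype.range_coe]
  refine ⟨Set.range σ, fun t ↦ E.symm t, Subtype.val_injective.comp E.symm.injective, ?_, ?_⟩
  · rw [hr]
    intro g hg
    -- The terms `f c` are chosen with no continuity in `c`; only their values `g c` must be
    -- continuous.
    choose f hf using hg
    exact ⟨.op f, Term.eval_op Y v f g hf⟩
  · rw [hr]
    exact fun a ↦ ⟨.var a, by rw [Term.eval]⟩

end Generation

/-! ### The solution set condition -/

section SolutionSet

/-- Contraspace structures on the subsets of a given set. -/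
structure SubsetStructure (C : CGWH.{u}) (T : Type u) : Type u where
  /-- The underlying subset. -/
  carrier : Set T
  /-- The topology, before `k`-ification. -/
  [topology : TopologicalSpace carrier]
  [weaklyHausdorff : WeaklyHausdorffSpace (Kification carrier)]
  /-- The structure map. -/
  action : (contraMonad C).obj (of (Kification carrier)) ⟶ of (Kification carrier)
  unit : (contraMonad C).η.app _ ≫ action = 𝟙 _
  assoc : (contraMonad C).μ.app _ ≫ action = (contraMonad C).map action ≫ action

attribute [instance] SubsetStructure.topology SubsetStructure.weaklyHausdorff

/-- The contraspace given by a contraspace structure on a subset. -/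
def SubsetStructure.toContraspace {T : Type u} (P : SubsetStructure C T) : Contraspace C :=
  ⟨of (Kification P.carrier), P.action, P.unit, P.assoc⟩

/-- The cocones on a small diagram of contraspaces satisfy the solution set condition. -/
theorem solutionSetCondition_const (J : Type u) [Category.{u} J] :
    SolutionSetCondition.{u} (Functor.const J : Contraspace C ⥤ J ⥤ Contraspace C) := by
  intro D
  let A : Type u := Σ j, (D.obj j).A.obj
  -- The index type is small: it ranges over structures on subsets of one fixed type of terms, each
  -- with a cocone.
  refine ⟨Σ P : SubsetStructure C (Term A C.obj), D ⟶ (Functor.const J).obj P.toContraspace,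
    fun i ↦ i.1.toContraspace, fun i ↦ i.2, fun Y h ↦ ?_⟩
  obtain ⟨s, e, hinj, hS, hv⟩ := Y.exists_isClosedUnder (A := A) fun x ↦ (h.app x.1).f.hom.hom x.2
  -- The subspace topology of the image of `e` in `Y`, transported to the set of terms `s`.
  let : TopologicalSpace s := .induced e inferInstance
  have he : IsEmbedding e := ⟨⟨rfl⟩, hinj⟩
  have := weaklyHausdorffSpace_kification Y he
  let B := subspace he hS
  let k : D ⟶ (Functor.const J).obj B :=
    { app j := subspaceLift he hS (h.app j) fun w ↦ hv ⟨j, w⟩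
      naturality i j f := by
        rw [← cancel_mono (subspaceInclusion he hS), Category.assoc, Category.assoc,
          subspaceLift_comp]
        exact (h.naturality f).trans <| (Category.comp_id _).trans <|
          (subspaceLift_comp he hS (h.app i) _).symm.trans <| congrArg _ (Category.id_comp _).symm }
  exact ⟨⟨⟨s, B.a, B.unit, B.assoc⟩, k⟩, subspaceInclusion he hS,
    NatTrans.ext (funext fun j ↦ subspaceLift_comp he hS _ _)⟩

end SolutionSet

end Contraspace

end CGWH

theorem mainTheorem8 (C : CGWH.{u}) : HasColimitsOfSize.{u, u} (CGWH.Contraspace C) where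
  has_colimits_of_shape J _ := hasColimitsOfShape_iff_isRightAdjoint_const.2 <|
    isRightAdjoint_of_preservesLimits_of_solutionSetCondition _
      (CGWH.Contraspace.solutionSetCondition_const J)
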